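/- There exist a finite $y_0>0$ and a function $f_1:[0,y_0]\to\mathbb R$, of class $C^4$ on $[0,y_0)$ and of class $C^1$ on $[0,y_0]$, that solves the free-boundary problem $$-\bigl(|1-f^2|\,f'''\bigr)'+\tfrac14\,y\,f'=0\quad\text{for } 0<y<y_0,$$ $$f(0)=f''(0)=0,\qquad f(y_0)=1,\qquad f'(y_0)=0,\qquad \bigl(|1-f^2|\,f'''\bigr)(y_0)=0,$$ where the derivatives at the end points $0$ and $y_0$ are one-sided and the last condition (zero flux at the interface, where the equation degenerates) means $\lim_{y\to y_0^-}|1-f(y)^2|\,f'''(y)=0$. Moreover, $$f_1'(y)>0,\qquad f_1''(y)<0\qquad\text{and}\qquad 0<f_1(y)<1\qquad\text{for all } y\in(0,y_0).$$ -/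

import Mathlib

namespace ThinFilm

open Set Filter Topology

/-- The rescaled mass flux `|1 - f²| f'''` of a profile `f` (meaningful at points around which `f` is
three times differentiable). -/
noncomputable def flux (f : ℝ → ℝ) (y : ℝ) : ℝ :=
  |1 - f y ^ 2| * iteratedDeriv 3 f y

/-- `f` is a classical solution on `[0, y₀]`, with finite interface `y₀ > 0`, of the free-boundary
problem `-(|1 - f²| f''')' + ¼ f' y = 0` on `(0, y₀)`, `f(0) = f''(0) = 0`,
`f(y₀) = 1`, `f'(y₀) = (|1 - f²| f''')(y₀) = 0`.
Only the values of `f` on `[0, y₀]` matter, so derivatives at the end points are one-sided. The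
equation degenerates at `y₀`, where `f''` and `f'''` are not required to exist; the flux there is
its limit from the left. -/
structure IsFBPSolution (y₀ : ℝ) (f : ℝ → ℝ) : Prop where
  interface_pos : 0 < y₀
  contDiffOn_four : ContDiffOn ℝ 4 f (Ico 0 y₀)
  contDiffOn_one : ContDiffOn ℝ 1 f (Icc 0 y₀)
  flux_differentiable : ∀ y ∈ Ioo 0 y₀, DifferentiableAt ℝ (flux f) y
  ode : ∀ y ∈ Ioo 0 y₀, -deriv (flux f) y + 1 / 4 * deriv f y * y = 0
  at_zero : f 0 = 0
  second_deriv_at_zero : iteratedDerivWithin 2 f (Ico 0 y₀) 0 = 0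
  at_interface : f y₀ = 1
  zero_contact_angle : derivWithin f (Icc 0 y₀) y₀ = 0
  zero_flux : Tendsto (flux f) (𝓝[<] y₀) (𝓝 0)

end ThinFilm

namespace ThinFilm

open Set Filter Topology

/-! Put `f y = 1 - u (y / b) / m` with `u = profile g`, `m = u 0`. The boundary conditions on `f`
and `f'` are then built in. Integrating the equation from the interface, where the flux vanishes,
and choosing `b ^ 4 * m = 4` removes `b` and leaves `g = (x + U / u) / (2 - u / m)` with `U = tail
u`: a fixed point of `rhs`.

The degenerate quotients are controlled because `u` and `U` are positive linear functionals of `g`: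
for every `g ≥ 0`, `(1 - x) / 3 ≤ U / u ≤ (1 - x) / 2` and `(1 - x) ^ 2 ≤ u / m ≤ 1 - x` wherever
these make sense. So `rhs` preserves the bounds `1/3 ≤ g ≤ 1/2` (`rhs_mem`). Applied to `e ± (g₁ -
g₂) ≥ 0`, the same inequalities make `rhs` a sup-norm contraction (`abs_rhs_sub_rhs_le`). The signs
of `f'` and `f''` follow from `g > 0`. -/

/-! ### Iterated integrals: calculus, linearity, positivity -/

/-- The primitive of `p` vanishing at `0`. -/
noncomputable def prim (p : ℝ → ℝ) (x : ℝ) : ℝ := ∫ s in (0 : ℝ)..x, p s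

/-- The integral of `p` from a point up to `1`. -/
noncomputable def tail (p : ℝ → ℝ) (x : ℝ) : ℝ := ∫ s in x..(1 : ℝ), p s

/-- The solution `u` of `u''' = p`, `u''(0) = u'(1) = u(1) = 0`. -/
noncomputable def profile (p : ℝ → ℝ) : ℝ → ℝ := tail (tail (prim p))

lemma hasDerivAt_prim {p : ℝ → ℝ} (hp : Continuous p) (x : ℝ) : HasDerivAt (prim p) (p x) x :=
  intervalIntegral.integral_hasDerivAt_right (hp.intervalIntegrable _ _)
    hp.stronglyMeasurable.stronglyMeasurableAtFilter hp.continuousAt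

lemma hasDerivAt_tail {p : ℝ → ℝ} (hp : Continuous p) (x : ℝ) : HasDerivAt (tail p) (-p x) x :=
  intervalIntegral.integral_hasDerivAt_left (hp.intervalIntegrable _ _)
    hp.stronglyMeasurable.stronglyMeasurableAtFilter hp.continuousAt

lemma continuous_prim {p : ℝ → ℝ} (hp : Continuous p) : Continuous (prim p) :=
  continuous_iff_continuousAt.2 fun x => (hasDerivAt_prim hp x).continuousAt

lemma continuous_tail {p : ℝ → ℝ} (hp : Continuous p) : Continuous (tail p) :=
  continuous_iff_continuousAt.2 fun x => (hasDerivAt_tail hp x).continuousAt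

lemma continuous_profile {p : ℝ → ℝ} (hp : Continuous p) : Continuous (profile p) :=
  continuous_tail (continuous_tail (continuous_prim hp))

@[simp] lemma prim_zero (p : ℝ → ℝ) : prim p 0 = 0 := by simp [prim]

@[simp] lemma tail_one (p : ℝ → ℝ) : tail p 1 = 0 := by simp [tail]

@[simp] lemma profile_one (p : ℝ → ℝ) : profile p 1 = 0 := tail_one _

lemma prim_linear {p q : ℝ → ℝ} (hp : Continuous p) (hq : Continuous q) (a b : ℝ) :
    prim (fun x => a * p x + b * q x) = fun x => a * prim p x + b * prim q x := by
  funext x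
  simp only [prim]
  rw [intervalIntegral.integral_add, intervalIntegral.integral_const_mul,
    intervalIntegral.integral_const_mul]
  · exact (hp.const_mul a).intervalIntegrable _ _
  · exact (hq.const_mul b).intervalIntegrable _ _

lemma tail_linear {p q : ℝ → ℝ} (hp : Continuous p) (hq : Continuous q) (a b : ℝ) :
    tail (fun x => a * p x + b * q x) = fun x => a * tail p x + b * tail q x := by
  funext x
  simp only [tail]
  rw [intervalIntegral.integral_add, intervalIntegral.integral_const_mul,
    intervalIntegral.integral_const_mul]
  · exact (hp.const_mul a).intervalIntegrable _ _
  · exact (hq.const_mul b).intervalIntegrable _ _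

lemma profile_linear {p q : ℝ → ℝ} (hp : Continuous p) (hq : Continuous q) (a b : ℝ) :
    profile (fun x => a * p x + b * q x) = fun x => a * profile p x + b * profile q x := by
  have hP := continuous_prim hp
  have hQ := continuous_prim hq
  rw [profile, prim_linear hp hq, tail_linear hP hQ,
    tail_linear (continuous_tail hP) (continuous_tail hQ)]
  rfl

lemma prim_pos {p : ℝ → ℝ} (hp : Continuous p) (hpos : ∀ x, 0 < p x) {x : ℝ} (hx : 0 < x) :
    0 < prim p x :=
  intervalIntegral.intervalIntegral_pos_of_pos (hp.intervalIntegrable _ _) hpos hx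

lemma tail_pos {p : ℝ → ℝ} (hp : Continuous p) (hpos : ∀ x ∈ Ioo (0 : ℝ) 1, 0 < p x) {x : ℝ}
    (hx : x ∈ Ico (0 : ℝ) 1) : 0 < tail p x :=
  intervalIntegral.intervalIntegral_pos_of_pos_on (hp.intervalIntegrable _ _)
    (fun y hy => hpos y ⟨hx.1.trans_lt hy.1, hy.2⟩) hx.2

lemma tail_prim_pos {p : ℝ → ℝ} (hp : Continuous p) (hpos : ∀ x, 0 < p x) {x : ℝ}
    (hx : x ∈ Ico (0 : ℝ) 1) : 0 < tail (prim p) x :=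
  tail_pos (continuous_prim hp) (fun _ hy => prim_pos hp hpos hy.1) hx

lemma profile_pos {p : ℝ → ℝ} (hp : Continuous p) (hpos : ∀ x, 0 < p x) {x : ℝ}
    (hx : x ∈ Ico (0 : ℝ) 1) : 0 < profile p x :=
  tail_pos (continuous_tail (continuous_prim hp))
    (fun _ hy => tail_prim_pos hp hpos ⟨hy.1.le, hy.2⟩) hx

/-! ### Comparison inequalities for nonnegative `p` -/

lemma nonneg_of_deriv_nonpos {f f' : ℝ → ℝ} (hf : ∀ x, HasDerivAt f (f' x) x) (h1 : f 1 = 0)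
    (h : ∀ x ∈ Icc (0 : ℝ) 1, f' x ≤ 0) : ∀ x ∈ Icc (0 : ℝ) 1, 0 ≤ f x := by
  intro x hx
  have hanti : AntitoneOn f (Icc (0 : ℝ) 1) := by
    refine antitoneOn_of_deriv_nonpos (convex_Icc 0 1)
      (fun y _ => (hf y).continuousAt.continuousWithinAt)
      (fun y _ => (hf y).differentiableAt.differentiableWithinAt) fun y hy => ?_
    rw [(hf y).deriv]
    exact h y (interior_subset hy)
  simpa [h1] using hanti hx (right_mem_Icc.2 zero_le_one) hx.2

lemma prim_nonneg {p : ℝ → ℝ} (h0 : ∀ x, 0 ≤ p x) {x : ℝ} (hx : 0 ≤ x) : 0 ≤ prim p x :=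
  intervalIntegral.integral_nonneg hx fun y _ => h0 y

lemma tail_nonneg {p : ℝ → ℝ} (h0 : ∀ x ∈ Icc (0 : ℝ) 1, 0 ≤ p x) {x : ℝ}
    (hx : x ∈ Icc (0 : ℝ) 1) : 0 ≤ tail p x :=
  intervalIntegral.integral_nonneg hx.2 fun y hy => h0 y ⟨hx.1.trans hy.1, hy.2⟩

lemma profile_nonneg {p : ℝ → ℝ} (h0 : ∀ x, 0 ≤ p x) {x : ℝ} (hx : x ∈ Icc (0 : ℝ) 1) :
    0 ≤ profile p x :=
  tail_nonneg (fun _ hy => tail_nonneg (fun _ hz => prim_nonneg h0 hz.1) hy) hx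

lemma hasDerivAt_one_sub (x : ℝ) : HasDerivAt (fun y : ℝ => 1 - y) (-1) x := by
  simpa using (hasDerivAt_id x).const_sub 1

lemma profile_le_mul_tail_prim {p : ℝ → ℝ} (hp : Continuous p) (h0 : ∀ x, 0 ≤ p x) :
    ∀ x ∈ Icc (0 : ℝ) 1, 0 ≤ (1 - x) * tail (prim p) x - profile p x := by
  have hP := continuous_prim hp
  refine nonneg_of_deriv_nonpos (fun x => (((hasDerivAt_one_sub x).mul (hasDerivAt_tail hP x)).sub
    (hasDerivAt_tail (continuous_tail hP) x))) (by simp) fun x hx => ?_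
  have := mul_nonneg (sub_nonneg.2 hx.2) (prim_nonneg h0 hx.1)
  linarith

/-- Since `p ≥ 0`, `prim p` is nondecreasing on `[0, 1]`, so its tail dominates `(1 - x) * prim p
x`; one more integration gives the factor `2`. -/
lemma mul_tail_prim_le_profile {p : ℝ → ℝ} (hp : Continuous p) (h0 : ∀ x, 0 ≤ p x) :
    ∀ x ∈ Icc (0 : ℝ) 1, 0 ≤ 2 * profile p x - (1 - x) * tail (prim p) x := by
  have hP := continuous_prim hp
  have hE : ∀ x ∈ Icc (0 : ℝ) 1, 0 ≤ tail (prim p) x - (1 - x) * prim p x := by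
    refine nonneg_of_deriv_nonpos (fun x => (hasDerivAt_tail hP x).sub
      ((hasDerivAt_one_sub x).mul (hasDerivAt_prim hp x))) (by simp) fun x hx => ?_
    have := mul_nonneg (sub_nonneg.2 hx.2) (h0 x)
    linarith
  refine nonneg_of_deriv_nonpos (fun x => ((hasDerivAt_tail (continuous_tail hP) x).const_mul
    2).sub ((hasDerivAt_one_sub x).mul (hasDerivAt_tail hP x))) (by simp) fun x hx => ?_
  have := hE x hx
  linarith

lemma tail_profile_le {p : ℝ → ℝ} (hp : Continuous p) (h0 : ∀ x, 0 ≤ p x) {x : ℝ}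
    (hx : x ∈ Icc (0 : ℝ) 1) : tail (profile p) x ≤ (1 - x) / 2 * profile p x := by
  have hP := continuous_prim hp
  suffices ∀ x ∈ Icc (0 : ℝ) 1, 0 ≤ (1 - x) * profile p x - 2 * tail (profile p) x by
    linarith [this x hx]
  refine nonneg_of_deriv_nonpos (fun x => ((hasDerivAt_one_sub x).mul
    (hasDerivAt_tail (continuous_tail hP) x)).sub
    ((hasDerivAt_tail (continuous_profile hp) x).const_mul 2)) (by simp) fun x hx => ?_
  have := profile_le_mul_tail_prim hp h0 x hx
  simp only [profile] at *
  linarith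

lemma le_tail_profile {p : ℝ → ℝ} (hp : Continuous p) (h0 : ∀ x, 0 ≤ p x) {x : ℝ}
    (hx : x ∈ Icc (0 : ℝ) 1) : (1 - x) / 3 * profile p x ≤ tail (profile p) x := by
  have hP := continuous_prim hp
  suffices ∀ x ∈ Icc (0 : ℝ) 1, 0 ≤ 3 * tail (profile p) x - (1 - x) * profile p x by
    linarith [this x hx]
  refine nonneg_of_deriv_nonpos (fun x => ((hasDerivAt_tail (continuous_profile hp) x).const_mul
    3).sub ((hasDerivAt_one_sub x).mul
    (hasDerivAt_tail (continuous_tail hP) x))) (by simp) fun x hx => ?_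
  have := mul_tail_prim_le_profile hp h0 x hx
  simp only [profile] at *
  linarith

/-- The quotient `u / (1 - x)` is nonincreasing: the sign of its derivative is
`profile_le_mul_tail_prim`. -/
lemma profile_le {p : ℝ → ℝ} (hp : Continuous p) (h0 : ∀ x, 0 ≤ p x) {x : ℝ}
    (hx : x ∈ Icc (0 : ℝ) 1) : profile p x ≤ (1 - x) * profile p 0 := by
  have hP := continuous_prim hp
  have hd : ∀ y ∈ Ico (0 : ℝ) 1, HasDerivAt (fun x => profile p x / (1 - x))
      ((-tail (prim p) y * (1 - y) - profile p y * (-1)) / (1 - y) ^ 2) y := fun y hy =>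
    (hasDerivAt_tail (continuous_tail hP) y).div (hasDerivAt_one_sub y) (by linarith [hy.2])
  have hanti : AntitoneOn (fun x => profile p x / (1 - x)) (Ico (0 : ℝ) 1) := by
    refine antitoneOn_of_deriv_nonpos (convex_Ico 0 1)
      (fun y hy => (hd y hy).continuousAt.continuousWithinAt)
      (fun y hy => (hd y (interior_subset hy)).differentiableAt.differentiableWithinAt)
      fun y hy => ?_
    have hy := interior_subset hy
    rw [(hd y hy).deriv]
    refine div_nonpos_of_nonpos_of_nonneg ?_ (sq_nonneg _)
    linarith [profile_le_mul_tail_prim hp h0 y ⟨hy.1, hy.2.le⟩]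
  rcases hx.2.eq_or_lt with rfl | h1
  · simp
  · have := hanti (left_mem_Ico.2 zero_lt_one) ⟨hx.1, h1⟩ hx.1
    simp only [sub_zero, div_one] at this
    rwa [div_le_iff₀' (by linarith)] at this

/-- The quotient `u / (1 - x) ^ 2` is nondecreasing: the sign of its derivative is
`mul_tail_prim_le_profile`. -/
lemma le_profile {p : ℝ → ℝ} (hp : Continuous p) (h0 : ∀ x, 0 ≤ p x) {x : ℝ}
    (hx : x ∈ Icc (0 : ℝ) 1) : (1 - x) ^ 2 * profile p 0 ≤ profile p x := by
  have hP := continuous_prim hp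
  have hd : ∀ y ∈ Ico (0 : ℝ) 1, HasDerivAt (fun x => profile p x / (1 - x) ^ 2)
      ((-tail (prim p) y * (1 - y) ^ 2 - profile p y * (2 * (1 - y) * (-1)))
        / ((1 - y) ^ 2) ^ 2) y := fun y hy => by
    have h1 : HasDerivAt (fun x : ℝ => (1 - x) ^ 2) (2 * (1 - y) * (-1)) y := by
      simpa using (hasDerivAt_one_sub y).fun_pow 2
    exact (hasDerivAt_tail (continuous_tail hP) y).div h1
      (pow_ne_zero 2 (by linarith [hy.2]))
  have hmono : MonotoneOn (fun x => profile p x / (1 - x) ^ 2) (Ico (0 : ℝ) 1) := by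
    refine monotoneOn_of_deriv_nonneg (convex_Ico 0 1)
      (fun y hy => (hd y hy).continuousAt.continuousWithinAt)
      (fun y hy => (hd y (interior_subset hy)).differentiableAt.differentiableWithinAt)
      fun y hy => ?_
    have hy := interior_subset hy
    rw [(hd y hy).deriv]
    refine div_nonneg ?_ (sq_nonneg _)
    have := mul_nonneg (sub_nonneg.2 hy.2.le)
      (mul_tail_prim_le_profile hp h0 y ⟨hy.1, hy.2.le⟩)
    linarith
  rcases hx.2.eq_or_lt with rfl | h1
  · simp
  · have := hmono (left_mem_Ico.2 zero_lt_one) ⟨hx.1, h1⟩ hx.1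
    simp only [sub_zero, one_pow, div_one] at this
    rwa [le_div_iff₀' (by have := sub_pos.2 h1; positivity)] at this

/-! ### The fixed-point map and its contraction estimate -/

/-- A quotient `V / v` of two positive linear functionals with `a v ≤ V ≤ b v` is Lipschitz; here
`w`, `W` are the values at the constant function `1`. -/
lemma abs_div_sub_div_le {a b e v₁ v₂ w V₁ V₂ W : ℝ}
    (hv₁ : 0 < v₁) (hv₂ : 0 < v₂) (hw : w ≤ 3 * v₁)
    (hV₂ : a * v₂ ≤ V₂) (hV₂' : V₂ ≤ b * v₂)
    (hp : 0 ≤ e * w + (v₁ - v₂)) (hq : 0 ≤ e * w - (v₁ - v₂))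
    (hp₁ : a * (e * w + (v₁ - v₂)) ≤ e * W + (V₁ - V₂))
    (hp₂ : e * W + (V₁ - V₂) ≤ b * (e * w + (v₁ - v₂)))
    (hq₁ : a * (e * w - (v₁ - v₂)) ≤ e * W - (V₁ - V₂))
    (hq₂ : e * W - (V₁ - V₂) ≤ b * (e * w - (v₁ - v₂))) (he : 0 ≤ e) :
    |V₁ / v₁ - V₂ / v₂| ≤ 3 * e * (b - a) := by
  set r := V₂ / v₂ with hr
  have hra : a ≤ r := by rwa [hr, le_div_iff₀ hv₂]
  have hrb : r ≤ b := by rwa [hr, div_le_iff₀ hv₂]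
  have hV : V₂ = r * v₂ := by rw [hr]; field_simp
  have hdiff : V₁ / v₁ - r = ((V₁ - V₂) - r * (v₁ - v₂)) / v₁ := by
    rw [hV]; field_simp; ring
  have hew : (b - a) * (e * w) ≤ (b - a) * (e * (3 * v₁)) := by
    gcongr
    linarith
  have h1 := mul_nonneg (sub_nonneg.2 hra) hp
  have h2 := mul_nonneg (sub_nonneg.2 hra) hq
  have h3 := mul_nonneg (sub_nonneg.2 hrb) hp
  have h4 := mul_nonneg (sub_nonneg.2 hrb) hq
  rw [hdiff, abs_div, abs_of_pos hv₁, div_le_iff₀ hv₁, abs_le]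
  constructor <;> linarith

/-- The right-hand side of the rescaled equation: the profile `u` of `g` gives a solution of the
free-boundary problem exactly when `g` is a fixed point. -/
noncomputable def rhs (g : ℝ → ℝ) (x : ℝ) : ℝ :=
  (x + tail (profile g) x / profile g x) / (2 - profile g x / profile g 0)

lemma profile_zero_pos {g : ℝ → ℝ} (hg : Continuous g) (h : ∀ x, 0 < g x) : 0 < profile g 0 :=
  profile_pos hg h (left_mem_Ico.2 zero_lt_one)

lemma tail_div_mem {g : ℝ → ℝ} (hg : Continuous g) (h : ∀ x, 0 < g x) {x : ℝ}
    (hx : x ∈ Icc (0 : ℝ) 1) :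
    tail (profile g) x / profile g x ∈ Icc ((1 - x) / 3) ((1 - x) / 2) := by
  rcases hx.2.eq_or_lt with rfl | h1
  · simp
  · have hpos := profile_pos hg h ⟨hx.1, h1⟩
    exact ⟨(le_div_iff₀ hpos).2 (le_tail_profile hg (fun x => (h x).le) hx),
      (div_le_iff₀ hpos).2 (tail_profile_le hg (fun x => (h x).le) hx)⟩

lemma profile_div_mem {g : ℝ → ℝ} (hg : Continuous g) (h : ∀ x, 0 < g x) {x : ℝ}
    (hx : x ∈ Icc (0 : ℝ) 1) :
    profile g x / profile g 0 ∈ Icc ((1 - x) ^ 2) (1 - x) := by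
  have hpos := profile_zero_pos hg h
  exact ⟨(le_div_iff₀ hpos).2 (le_profile hg (fun x => (h x).le) hx),
    (div_le_iff₀ hpos).2 (profile_le hg (fun x => (h x).le) hx)⟩

lemma rhs_mem {g : ℝ → ℝ} (hg : Continuous g) (h : ∀ x, 0 < g x) {x : ℝ}
    (hx : x ∈ Icc (0 : ℝ) 1) : rhs g x ∈ Icc (1 / 3 : ℝ) (1 / 2) := by
  obtain ⟨hr1, hr2⟩ := tail_div_mem hg h hx
  obtain ⟨hh1, hh2⟩ := profile_div_mem hg h hx
  have hpos : 0 < 2 - profile g x / profile g 0 := by linarith [hx.1]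
  rw [rhs, mem_Icc, le_div_iff₀ hpos, div_le_iff₀ hpos]
  constructor
  · nlinarith [sq_nonneg x]
  · linarith

lemma continuousOn_rhs {g : ℝ → ℝ} (hg : Continuous g) (h : ∀ x, 0 < g x) :
    ContinuousOn (rhs g) (Icc 0 1) := by
  have hc := continuous_profile hg
  refine ContinuousOn.div (continuousOn_id.add ?_)
    (continuous_const.sub (hc.div_const _)).continuousOn fun x hx => ?_
  · intro x hx
    rcases hx.2.eq_or_lt with rfl | h1
    -- At `x = 1` the quotient is `0 / 0`, which Lean evaluates to `0`; this is also its limit, by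
    -- squeezing.
    · have hlim (c : ℝ) : Tendsto (fun x : ℝ => (1 - x) / c) (𝓝[Icc 0 1] 1) (𝓝 0) := by
        have : Continuous fun x : ℝ => (1 - x) / c := by fun_prop
        simpa using (this.tendsto 1).mono_left (nhdsWithin_le_nhds (s := Icc (0 : ℝ) 1))
      simp only [ContinuousWithinAt, tail_one, zero_div]
      refine tendsto_of_tendsto_of_tendsto_of_le_of_le' (hlim 3) (hlim 2) ?_ ?_ <;>
      filter_upwards [self_mem_nhdsWithin] with y hy
      · exact (tail_div_mem hg h hy).1
      · exact (tail_div_mem hg h hy).2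
    · exact ((continuous_tail hc).continuousAt.div hc.continuousAt
        (profile_pos hg h ⟨hx.1, h1⟩).ne').continuousWithinAt
  · linarith [(profile_div_mem hg h hx).2, hx.1]

lemma abs_div_sub_div_le_of_rhs {x r₁ r₂ h₁ h₂ e : ℝ} (hx : x ∈ Icc (0 : ℝ) 1) (he : 0 ≤ e)
    (hr₁ : r₁ ≤ (1 - x) / 2) (hr₁' : (1 - x) / 3 ≤ r₁) (hh₁ : h₁ ≤ 1 - x) (hh₂ : h₂ ≤ 1 - x)
    (hr : |r₁ - r₂| ≤ e * (1 - x) / 2) (hh : |h₁ - h₂| ≤ 3 * e * (x * (1 - x))) :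
    |(x + r₁) / (2 - h₁) - (x + r₂) / (2 - h₂)| ≤ 3 / 5 * e := by
  obtain ⟨hx0, hx1⟩ := hx
  have p1 : 0 < 2 - h₁ := by linarith
  have p2 : 0 < 2 - h₂ := by linarith
  have hG : (x + r₁) / (2 - h₁) ≤ 1 / 2 := by rw [div_le_iff₀ p1]; linarith
  have hG0 : 0 ≤ (x + r₁) / (2 - h₁) := div_nonneg (by linarith) p1.le
  have key : (x + r₁) / (2 - h₁) - (x + r₂) / (2 - h₂) =
      ((r₁ - r₂) + (x + r₁) / (2 - h₁) * (h₁ - h₂)) / (2 - h₂) := by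
    field_simp; ring
  rw [key, abs_div, abs_of_pos p2, div_le_iff₀ p2]
  have hm : |(x + r₁) / (2 - h₁) * (h₁ - h₂)| ≤ 1 / 2 * (3 * e * (x * (1 - x))) := by
    rw [abs_mul, abs_of_nonneg hG0]
    gcongr
  -- The constant `3/5` works because `1/10 - 2x/5 + 3x²/2`, minimal at `x = 2/15`, is positive.
  have h5 : e * (1 - x) / 2 + 1 / 2 * (3 * e * (x * (1 - x))) ≤ 3 / 5 * e * (1 + x) := by
    have : 0 ≤ e * (1 / 10 - 2 / 5 * x + 3 / 2 * x ^ 2) :=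
      mul_nonneg he (by nlinarith [sq_nonneg (x - 2 / 15)])
    linarith
  have h6 : 3 / 5 * e * (1 + x) ≤ 3 / 5 * e * (2 - h₂) := by
    gcongr; linarith
  linarith [abs_add_le (r₁ - r₂) ((x + r₁) / (2 - h₁) * (h₁ - h₂))]

lemma abs_rhs_sub_rhs_le {g₁ g₂ : ℝ → ℝ} {e : ℝ} (hg₁ : Continuous g₁) (hg₂ : Continuous g₂)
    (h₁ : ∀ x, 1 / 3 ≤ g₁ x) (h₂ : ∀ x, 1 / 3 ≤ g₂ x) (he : ∀ x, |g₁ x - g₂ x| ≤ e) {x : ℝ}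
    (hx : x ∈ Icc (0 : ℝ) 1) : |rhs g₁ x - rhs g₂ x| ≤ 3 / 5 * e := by
  have e0 : 0 ≤ e := (abs_nonneg _).trans (he 0)
  have h₁' : ∀ x, 0 < g₁ x := fun x => by linarith [h₁ x]
  have h₂' : ∀ x, 0 < g₂ x := fun x => by linarith [h₂ x]
  -- The constant function is kept opaque, and `d` is written with coefficients `1` and `-1`, to
  -- match the form of the linearity lemmas.
  obtain ⟨one, hone, cone⟩ : ∃ one : ℝ → ℝ, (∀ x, one x = 1) ∧ Continuous one :=
    ⟨fun _ => 1, fun _ => rfl, continuous_const⟩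
  set d : ℝ → ℝ := fun x => 1 * g₁ x + (-1) * g₂ x with hd
  have cd : Continuous d := by fun_prop
  set p : ℝ → ℝ := fun x => e * one x + 1 * d x with hpdef
  set q : ℝ → ℝ := fun x => e * one x + (-1) * d x with hqdef
  have cp : Continuous p := by fun_prop
  have cq : Continuous q := by fun_prop
  have p0 : ∀ x, 0 ≤ p x := fun x => by
    simp only [hpdef, hd, hone]; linarith [(abs_le.1 (he x)).1]
  have q0 : ∀ x, 0 ≤ q x := fun x => by
    simp only [hqdef, hd, hone]; linarith [(abs_le.1 (he x)).2]
  have up (y : ℝ) : profile p y = e * profile one y + (profile g₁ y - profile g₂ y) := by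
    rw [hpdef, profile_linear cone cd, hd, profile_linear hg₁ hg₂]; ring
  have uq (y : ℝ) : profile q y = e * profile one y - (profile g₁ y - profile g₂ y) := by
    rw [hqdef, profile_linear cone cd, hd, profile_linear hg₁ hg₂]; ring
  have Up (y : ℝ) : tail (profile p) y =
      e * tail (profile one) y + (tail (profile g₁) y - tail (profile g₂) y) := by
    rw [hpdef, profile_linear cone cd, tail_linear (continuous_profile cone)
      (continuous_profile cd), hd, profile_linear hg₁ hg₂, tail_linear (continuous_profile hg₁)
      (continuous_profile hg₂)]
    ring
  have Uq (y : ℝ) : tail (profile q) y =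
      e * tail (profile one) y - (tail (profile g₁) y - tail (profile g₂) y) := by
    rw [hqdef, profile_linear cone cd, tail_linear (continuous_profile cone)
      (continuous_profile cd), hd, profile_linear hg₁ hg₂, tail_linear (continuous_profile hg₁)
      (continuous_profile hg₂)]
    ring
  -- The lower bound `1/3 ≤ g₁` enters here: `3 * g₁ - 1 ≥ 0`.
  have hw {y : ℝ} (hy : y ∈ Icc (0 : ℝ) 1) : profile one y ≤ 3 * profile g₁ y := by
    have := profile_nonneg (p := fun x => 3 * g₁ x + (-1) * one x)
      (fun x => by rw [hone]; linarith [h₁ x]) hy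
    rw [profile_linear hg₁ cone] at this
    linarith
  have z : (0 : ℝ) ∈ Icc (0 : ℝ) 1 := by simp
  have hr : |tail (profile g₁) x / profile g₁ x - tail (profile g₂) x / profile g₂ x| ≤
      e * (1 - x) / 2 := by
    rcases hx.2.eq_or_lt with rfl | hx1
    · simp
    · refine (abs_div_sub_div_le (a := (1 - x) / 3) (b := (1 - x) / 2) (e := e)
        (w := profile one x) (W := tail (profile one) x) (profile_pos hg₁ h₁' ⟨hx.1, hx1⟩)
        (profile_pos hg₂ h₂' ⟨hx.1, hx1⟩) (hw hx) (le_tail_profile hg₂ (fun x => (h₂' x).le) hx)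
        (tail_profile_le hg₂ (fun x => (h₂' x).le) hx) ?_ ?_ ?_ ?_ ?_ ?_ e0).trans (by linarith)
      · rw [← up]; exact profile_nonneg p0 hx
      · rw [← uq]; exact profile_nonneg q0 hx
      · rw [← up, ← Up]; exact le_tail_profile cp p0 hx
      · rw [← up, ← Up]; exact tail_profile_le cp p0 hx
      · rw [← uq, ← Uq]; exact le_tail_profile cq q0 hx
      · rw [← uq, ← Uq]; exact tail_profile_le cq q0 hx
  have hh : |profile g₁ x / profile g₁ 0 - profile g₂ x / profile g₂ 0| ≤
      3 * e * (x * (1 - x)) := by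
    refine (abs_div_sub_div_le (a := (1 - x) ^ 2) (b := 1 - x) (e := e)
        (w := profile one 0) (W := profile one x) (profile_zero_pos hg₁ h₁')
        (profile_zero_pos hg₂ h₂') (hw z) (le_profile hg₂ (fun x => (h₂' x).le) hx)
        (profile_le hg₂ (fun x => (h₂' x).le) hx) ?_ ?_ ?_ ?_ ?_ ?_ e0).trans (by linarith)
    · rw [← up]; exact profile_nonneg p0 z
    · rw [← uq]; exact profile_nonneg q0 z
    · rw [← up, ← up]; exact le_profile cp p0 hx
    · rw [← up, ← up]; exact profile_le cp p0 hx
    · rw [← uq, ← uq]; exact le_profile cq q0 hx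
    · rw [← uq, ← uq]; exact profile_le cq q0 hx
  exact abs_div_sub_div_le_of_rhs hx e0 (tail_div_mem hg₁ h₁' hx).2 (tail_div_mem hg₁ h₁' hx).1
    (profile_div_mem hg₁ h₁' hx).2 (profile_div_mem hg₂ h₂' hx).2 hr hh

/-! ### Existence of the fixed point -/

open scoped BoundedContinuousFunction in
/-- The contraction mapping principle gives a fixed point of `rhs` on `[0, 1]`. -/
lemma exists_fixedPoint_rhs :
    ∃ g : ℝ → ℝ, Continuous g ∧ (∀ x, 0 < g x) ∧ ∀ x ∈ Icc (0 : ℝ) 1, rhs g x = g x := by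
  let S : Set (ℝ →ᵇ ℝ) := {g | ∀ x, g x ∈ Icc (1 / 3 : ℝ) (1 / 2)}
  have hS : IsClosed S := by
    simp only [S, ofPred_forall]
    exact isClosed_iInter fun x =>
      isClosed_Icc.preimage (continuous_eval_const x)
  have : CompleteSpace S := hS.completeSpace_coe
  have pos (g : S) (x : ℝ) : 0 < g.1 x := by linarith [(g.2 x).1]
  -- Clamping to `[0, 1]` extends `rhs g` to all of `ℝ` with the same bounds.
  have cl (x : ℝ) : max 0 (min x 1) ∈ Icc (0 : ℝ) 1 := by simp
  have mem (g : S) (x : ℝ) := rhs_mem g.1.continuous (pos g) (cl x)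
  let T : S → S := fun g =>
    ⟨BoundedContinuousFunction.ofNormedAddCommGroup (fun x => rhs g.1 (max 0 (min x 1)))
      ((continuousOn_rhs g.1.continuous (pos g)).comp_continuous (by fun_prop) cl) (1 / 2)
      (fun x => by
        rw [Real.norm_eq_abs, abs_le]
        constructor <;> linarith [(mem g x).1, (mem g x).2]), mem g⟩
  have hT : ContractingWith (3 / 5) T := by
    refine ⟨?_, LipschitzWith.of_dist_le_mul fun g₁ g₂ => ?_⟩
    · rw [← NNReal.coe_lt_coe]; norm_num
    · rw [Subtype.dist_eq, Subtype.dist_eq, BoundedContinuousFunction.dist_le (by positivity)]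
      intro x
      rw [Real.dist_eq]
      have := abs_rhs_sub_rhs_le g₁.1.continuous g₂.1.continuous (fun x => (g₁.2 x).1)
        (fun x => (g₂.2 x).1) (fun x => g₁.1.dist_coe_le_dist (g := g₂.1) x) (cl x)
      simpa [T] using this
  have : Nonempty S := ⟨BoundedContinuousFunction.const ℝ (1 / 3), fun x => by
    simp only [BoundedContinuousFunction.const_apply]; constructor <;> norm_num⟩
  refine ⟨(hT.fixedPoint T).1, (hT.fixedPoint T).1.continuous, pos _, fun x hx => ?_⟩
  have := congrArg (fun g : S => g.1 x) hT.fixedPoint_isFixedPt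
  simpa [T, hx.1, hx.2] using this

/-! ### Regularity and return to the free-boundary problem -/

lemma contDiffOn_succ_of_hasDerivWithinAt {f f' : ℝ → ℝ} {s : Set ℝ} {n : ℕ}
    (hs : UniqueDiffOn ℝ s) (hf : ∀ x ∈ s, HasDerivWithinAt f (f' x) s x)
    (hf' : ContDiffOn ℝ n f' s) : ContDiffOn ℝ (n + 1 : ℕ) f s := by
  push_cast
  refine (contDiffOn_succ_iff_derivWithin hs).2
    ⟨fun x hx => (hf x hx).differentiableWithinAt, by simp, hf'.congr fun x hx => ?_⟩
  exact (hf x hx).derivWithin (hs x hx)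

lemma contDiff_one_tail {p : ℝ → ℝ} (hp : Continuous p) : ContDiff ℝ 1 (tail p) := by
  refine contDiff_one_iff_deriv.2 ⟨fun x => (hasDerivAt_tail hp x).differentiableAt, ?_⟩
  rw [funext fun x => (hasDerivAt_tail hp x).deriv]
  exact hp.neg

lemma contDiffOn_rhs {g : ℝ → ℝ} (hg : Continuous g) (h : ∀ x, 0 < g x) :
    ContDiffOn ℝ 1 (rhs g) (Ico 0 1) := by
  have hu : ContDiff ℝ 1 (profile g) := contDiff_one_tail (continuous_tail (continuous_prim hg))
  refine ContDiffOn.div (contDiffOn_id.add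
    ((contDiff_one_tail (continuous_profile hg)).contDiffOn.div hu.contDiffOn fun x hx => (profile_pos hg h hx).ne'))
    (contDiff_const.sub (hu.div_const _)).contDiffOn fun x hx => ?_
  linarith [(profile_div_mem hg h (Ico_subset_Icc_self hx)).2, hx.1]

lemma hasDerivAt_comp_div_mul {F : ℝ → ℝ} {F' : ℝ} (b c y : ℝ) (hF : HasDerivAt F F' (y / b)) :
    HasDerivAt (fun y => F (y / b) / c) (F' / (c * b)) y := by
  rw [show F' / (c * b) = F' * (1 / b) / c by ring]
  exact (hF.comp y ((hasDerivAt_id y).div_const b)).div_const c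

/-- A fixed point of `rhs`, rescaled to `[0, b]`, solves the free-boundary problem. -/
lemma isFBPSolution_of_rhs_eq {g : ℝ → ℝ} (hg : Continuous g) (hpos : ∀ x, 0 < g x)
    (hfix : ∀ x ∈ Icc (0 : ℝ) 1, rhs g x = g x) {b : ℝ} (hb : 0 < b)
    (hbm : b ^ 4 * profile g 0 = 4) :
    IsFBPSolution b (fun y => 1 - profile g (y / b) / profile g 0) ∧
      ∀ y ∈ Ioo 0 b, 0 < deriv (fun y => 1 - profile g (y / b) / profile g 0) y ∧
        iteratedDeriv 2 (fun y => 1 - profile g (y / b) / profile g 0) y < 0 ∧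
        0 < 1 - profile g (y / b) / profile g 0 ∧ 1 - profile g (y / b) / profile g 0 < 1 := by
  have hm : 0 < profile g 0 := profile_zero_pos hg hpos
  have hP := continuous_prim hg
  have hQ := continuous_tail hP
  have hu := continuous_profile hg
  set m := profile g 0 with hm_def
  set f : ℝ → ℝ := fun y => 1 - profile g (y / b) / m with hf
  set f₁ : ℝ → ℝ := fun y => tail (prim g) (y / b) / (m * b) with hf₁
  set f₂ : ℝ → ℝ := fun y => -(prim g (y / b) / (m * b * b)) with hf₂
  set f₃ : ℝ → ℝ := fun y => -(g (y / b) / (m * b * b * b)) with hf₃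
  have d1 (y : ℝ) : HasDerivAt f (f₁ y) y := by
    have : HasDerivAt f _ y :=
      (hasDerivAt_comp_div_mul b m y (hasDerivAt_tail hQ (y / b))).const_sub 1
    rwa [neg_div, neg_neg] at this
  have d2 (y : ℝ) : HasDerivAt f₁ (f₂ y) y := by
    have := hasDerivAt_comp_div_mul b (m * b) y (hasDerivAt_tail hP (y / b))
    simpa only [neg_div] using this
  have d3 (y : ℝ) : HasDerivAt f₂ (f₃ y) y :=
    (hasDerivAt_comp_div_mul b (m * b * b) y (hasDerivAt_prim hg (y / b))).neg
  have e1 : deriv f = f₁ := funext fun y => (d1 y).deriv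
  have e2 : iteratedDeriv 2 f = f₂ := by
    rw [iteratedDeriv_succ, iteratedDeriv_one, e1]; exact funext fun y => (d2 y).deriv
  have e3 : iteratedDeriv 3 f = f₃ := by
    rw [iteratedDeriv_succ, e2]; exact funext fun y => (d3 y).deriv
  have c3 : Continuous f₃ := by fun_prop
  have scale {y : ℝ} (hy : y ∈ Ico 0 b) : y / b ∈ Ico (0 : ℝ) 1 :=
    ⟨div_nonneg hy.1 hb.le, (div_lt_one hb).2 hy.2⟩
  have scale' {y : ℝ} (hy : y ∈ Ioo 0 b) : y / b ∈ Ioo (0 : ℝ) 1 :=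
    ⟨div_pos hy.1 hb, (div_lt_one hb).2 hy.2⟩
  have hus : UniqueDiffOn ℝ (Ico 0 b) := uniqueDiffOn_Ico 0 b
  have k2 : ContDiff ℝ 2 f := by
    have k1 : ContDiff ℝ 1 f₁ := contDiff_one_iff_deriv.2
      ⟨fun y => (d2 y).differentiableAt, by
        rw [funext fun y => (d2 y).deriv]
        exact continuous_iff_continuousAt.2 fun y => (d3 y).continuousAt⟩
    have := (contDiff_succ_iff_deriv (n := 1) (f := f)).2
      ⟨fun y => (d1 y).differentiableAt, by simp, by rwa [e1]⟩
    simpa [one_add_one_eq_two] using this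
  have k4 : ContDiffOn ℝ 4 f (Ico 0 b) := by
    -- Bootstrap: `g` is only known to be continuous, but it equals `rhs g`, which is `C¹` away from
    -- `x = 1` because `u > 0` there.
    have q1 : ContDiffOn ℝ (1 : ℕ) f₃ (Ico 0 b) := by
      have : ContDiffOn ℝ 1 (fun y => -(rhs g (y / b) / (m * b * b * b))) (Ico 0 b) :=
        (((contDiffOn_rhs hg hpos).comp (t := Ico 0 1) (contDiff_id.div_const b).contDiffOn
          fun y hy => scale hy).div_const _).neg
      refine (this.congr fun y hy => ?_)
      simp only [hf₃, hfix _ (Ico_subset_Icc_self (scale hy))]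
    have q2 := contDiffOn_succ_of_hasDerivWithinAt hus
      (fun y _ => (d3 y).hasDerivWithinAt) q1
    have q3 := contDiffOn_succ_of_hasDerivWithinAt hus
      (fun y _ => (d2 y).hasDerivWithinAt) q2
    have q4 := contDiffOn_succ_of_hasDerivWithinAt hus
      (fun y _ => (d1 y).hasDerivWithinAt) q3
    exact_mod_cast q4
  have bounds {y : ℝ} (hy : y ∈ Ioo 0 b) : 0 < f y ∧ f y < 1 := by
    have hs := scale' hy
    have h1 := (profile_div_mem hg hpos (Ioo_subset_Icc_self hs)).2
    have h2 := div_pos (profile_pos hg hpos (Ioo_subset_Ico_self hs)) hm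
    simp only [hf]
    exact ⟨by linarith [hs.1], by linarith⟩
  -- Closed form of the flux from the fixed-point equation. It is differentiable across `y = b` and
  -- vanishes there, which gives the zero-flux limit.
  set Φ : ℝ → ℝ := fun y => -((y / b * profile g (y / b) + tail (profile g) (y / b))
    / (m ^ 2 * b ^ 3)) with hΦ
  have hflux {y : ℝ} (hy : y ∈ Ioo 0 b) : flux f y = Φ y := by
    have hs := scale' hy
    have hv := profile_pos hg hpos (Ioo_subset_Ico_self hs)
    have hI := Ioo_subset_Icc_self hs
    have hle := (profile_div_mem hg hpos hI).2
    have hne : 2 - profile g (y / b) / m ≠ 0 := by linarith [hs.1]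
    obtain ⟨b1, b2⟩ := bounds hy
    rw [flux, e3, abs_of_nonneg (by nlinarith)]
    simp only [hf₃, hΦ, hf]
    rw [← hfix _ hI, rhs, ← hm_def]
    generalize profile g (y / b) = v at *
    generalize tail (profile g) (y / b) = V at *
    generalize y / b = x at *
    have : x + V / v = (x * v + V) / v := by field_simp
    rw [this]
    have h3 : 1 - (1 - v / m) ^ 2 = (v / m) * (2 - v / m) := by ring
    rw [h3]
    generalize hz : 2 - v / m = z at *
    field_simp
  have dΦ (y : ℝ) : HasDerivAt Φ (y / b * tail (prim g) (y / b) / (m ^ 2 * b ^ 3 * b)) y := by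
    have h0 : HasDerivAt (fun x => x * profile g x + tail (profile g) x)
        (1 * profile g (y / b) + y / b * (-tail (prim g) (y / b)) + -profile g (y / b)) (y / b) :=
      ((hasDerivAt_id (y / b)).mul (hasDerivAt_tail hQ (y / b))).add (hasDerivAt_tail hu (y / b))
    have h1 : HasDerivAt Φ _ y := (hasDerivAt_comp_div_mul b (m ^ 2 * b ^ 3) y h0).neg
    refine h1.congr_deriv ?_
    ring
  have hev {y : ℝ} (hy : y ∈ Ioo 0 b) : flux f =ᶠ[𝓝 y] Φ := by
    filter_upwards [isOpen_Ioo.mem_nhds hy] with z hz using hflux hz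
  have dflux {y : ℝ} (hy : y ∈ Ioo 0 b) := (dΦ y).congr_of_eventuallyEq (hev hy)
  refine ⟨⟨hb, k4, (k2.of_le one_le_two).contDiffOn, fun y hy => (dflux hy).differentiableAt,
    fun y hy => ?_, ?_, ?_, ?_, ?_, ?_⟩, fun y hy => ⟨?_, ?_, bounds hy⟩⟩
  · rw [(dflux hy).deriv, e1]
    simp only [hf₁]
    -- The normalization of `b` produces the coefficient `1/4` of the equation.
    have : m = 4 / b ^ 4 := by field_simp; linarith
    rw [this]
    field_simp
    ring
  · simp [hf, ← hm_def, hm.ne']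
  · rw [iteratedDerivWithin_eq_iteratedDeriv hus k2.contDiffAt (left_mem_Ico.2 hb), e2]
    simp [hf₂]
  · simp [hf, hb.ne']
  · rw [(d1 b).hasDerivWithinAt.derivWithin (uniqueDiffOn_Icc hb b (right_mem_Icc.2 hb.le))]
    simp [hf₁, hb.ne']
  · have h0 : Φ b = 0 := by simp [hΦ, hb.ne']
    have := ((dΦ b).continuousAt.tendsto).mono_left (nhdsWithin_le_nhds (s := Iio b))
    rw [h0] at this
    refine this.congr' ?_
    filter_upwards [Ioo_mem_nhdsLT hb] with y hy using (hflux hy).symm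
  · rw [e1]
    exact div_pos (tail_prim_pos hg hpos (Ioo_subset_Ico_self (scale' hy))) (by positivity)
  · rw [e2]
    exact neg_neg_of_pos (div_pos (prim_pos hg hpos (scale' hy).1) (by positivity))

end ThinFilm

theorem proposition2p3 :
    ∃ (y₀ : ℝ) (f₁ : ℝ → ℝ), ThinFilm.IsFBPSolution y₀ f₁ ∧
      ∀ y ∈ Set.Ioo 0 y₀,
        0 < deriv f₁ y ∧ iteratedDeriv 2 f₁ y < 0 ∧ 0 < f₁ y ∧ f₁ y < 1 := by
  obtain ⟨g, hg, hpos, hfix⟩ := ThinFilm.exists_fixedPoint_rhs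
  have hm := ThinFilm.profile_zero_pos hg hpos
  have hb : 0 < (4 / ThinFilm.profile g 0) ^ (1 / 4 : ℝ) := by positivity
  refine ⟨_, _, ThinFilm.isFBPSolution_of_rhs_eq hg hpos hfix hb ?_⟩
  rw [← Real.rpow_natCast, ← Real.rpow_mul (by positivity)]
  norm_num
  field_simp
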